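/- Let $K$ be a positive integer and $t\in\mathbb R$. For the weight $w(x)=e^{-x^2}(x-t)^{2K}$ on $\mathbb R$, let $p_0,p_1,\dots$ be the monic orthogonal polynomials ($p_n$ is monic of degree $n$ and $\int_{\mathbb R}p_m(x)p_n(x)w(x)\,dx=0$ for $m\ne n$), and let $\alpha_n=\alpha_n(t)$, $\beta_n=\beta_n(t)$ be their recurrence coefficients, so that $$x\,p_n(x)=p_{n+1}(x)+\alpha_n\,p_n(x)+\beta_n\,p_{n-1}(x)\qquad(n\ge 0),$$ where the last term is absent for $n=0$. For integers $s$ put $P_s(x)=\sum_{i,j\ge0,\ i+2j=s}\frac{x^i}{6^j\,i!\,j!}$ (so $P_s=0$ for $s<0$), and for $m,n\ge0$ let $$H_{m,n}(x)=\det\bigl(P_{n-i+j}(x)\bigr)_{i,j=1}^{m}$$ be the generalized Hermite polynomials of Noumi and Yamada. Let $c=\sqrt{-3/2}$ (either of the two complex square roots). Then $H_{2K,n}(t/c)\neq0$ for all $n\ge0$ and all $t\in\mathbb R$, and $$\alpha_n(t)=-\frac12\,\frac{d}{dt}\log\frac{H_{2K,n+1}(t/c)}{H_{2K,n}(t/c)}\qquad(n\ge0,\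 t\in\mathbb R).$$ -/

import Mathlib

open Polynomial MeasureTheory

noncomputable section

/-- The Hermite weight perturbed by a real zero of multiplicity `2K` at `t`:
`w(x) = e^{-x²} (x - t)^{2K}`. -/
def perturbedHermiteWeight (K : ℕ) (t x : ℝ) : ℝ :=
  Real.exp (-x ^ 2) * (x - t) ^ (2 * K)

/-- `p 0, p 1, p 2, …` is the sequence of monic orthogonal polynomials on the real line for the
weight `w`: `p n` is monic of exact degree `n`, and `∫ p_m p_n w = h_n δ_{mn}` with `h_n > 0`. -/
structure IsMonicOrthogonalSequence (w : ℝ → ℝ) (p : ℕ → ℝ[X]) : Prop where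
  monic : ∀ n, (p n).Monic
  natDegree_eq : ∀ n, (p n).natDegree = n
  integrable : ∀ m n, Integrable (fun x : ℝ => (p m).eval x * (p n).eval x * w x)
  orthogonal : ∀ m n, m ≠ n → ∫ x : ℝ, (p m).eval x * (p n).eval x * w x = 0
  norm_sq_pos : ∀ n, 0 < ∫ x : ℝ, (p n).eval x * (p n).eval x * w x

/-- The three-term recurrence `x p_n = p_{n+1} + α_n p_n + β_n p_{n-1}`, `n ≥ 0`, where the last
term is absent for `n = 0`; `α_n` are the diagonal recurrence coefficients. -/
structure HasRecurrenceCoefficients (p : ℕ → ℝ[X]) (α β : ℕ → ℝ) : Prop where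
  zero : X * p 0 = p 1 + C (α 0) * p 0
  succ : ∀ n, X * p (n + 1) = p (n + 2) + C (α (n + 1)) * p (n + 1) + C (β (n + 1)) * p n

/-- `P_s(x) = ∑_{i + 2j = s} x^i / (6^j i! j!)`, the sum being over natural numbers `i, j`
(both are then at most `s`); in particular `P_s = 0` for `s < 0`. -/
def schurP (s : ℤ) : ℂ[X] :=
  ∑ ij ∈ (Finset.range (s.toNat + 1) ×ˢ Finset.range (s.toNat + 1)).filter
      (fun ij : ℕ × ℕ => (ij.1 : ℤ) + 2 * (ij.2 : ℤ) = s),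
    C (1 / ((6 : ℂ) ^ ij.2 * (ij.1.factorial : ℂ) * (ij.2.factorial : ℂ))) * X ^ ij.1

/-- The generalized Hermite polynomial `H_{m,n} = det (P_{n-i+j})_{i,j=1}^m`. -/
def genHermite (m n : ℕ) : ℂ[X] :=
  Matrix.det (Matrix.of fun i j : Fin m => schurP ((n : ℤ) - (i : ℕ) + (j : ℕ)))

end

/-!
Write `⟨q⟩ = ∫ q(x) e^{-x²} dx`, `m = 2K`, and let `π_n` be the monic Hermite polynomials, which
satisfy `π_n' = n π_{n-1}`. Up to the scaling `π_s(t) = s! c^s P_s(t / c)` the determinant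
`H_{m,n}(t / c)` is the Wronskian `W_n(t)` of `π_n, …, π_{n+m-1}`
(`det_hermiteWronskianMatrix_eq_genHermite`).

If `p_n` is the monic orthogonal polynomial for `w`, then `(X - t)^m p_n` is orthogonal, for the
Gaussian weight, to all degrees below `n`, so it is a combination of `π_n, …, π_{n+m}`. Its
vanishing to order `m` at `t` is a linear system with determinant `W_n(t)`. This determinant is
nonzero because `w ≥ 0` (`det_hermiteWronskianMatrix_ne_zero`), and Cramer's rule for the lowest
coefficient gives the squared norm
`h_n(t) = ∫ p_n² w = ⟨π_n²⟩ W_{n+1}(t) / W_n(t)` (`perturbedFunctional_mul_self_mul_det`).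

It remains to see that `h_n' = -2 α_n h_n` (`hasDerivAt_hermiteWronskian_quotient`). Here `p_n`
depends on `t`, but `h_n(s)` is the minimum of `⟨q² (X - s)^m⟩` over monic `q` of degree `n`, so
freezing `q` at the minimizer for `t` does not change the derivative at `t`. For frozen `q` the
derivative is `-2 ∫ x q² w = -2 α_n h_n`, by integration by parts
(`hasDerivAt_perturbedFunctional_mul_self`).

The quotient `H_{m,n+1}(s / c) / H_{m,n}(s / c)` is real of constant sign, negative for odd `K`.
The complex logarithm of this quotient is the real logarithm of `h_n(s)` plus a constant.
-/

/-! ### The Gaussian functional -/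

theorem integrable_eval_mul_gaussian (q : ℝ[X]) :
    Integrable (fun x : ℝ => q.eval x * Real.exp (-x ^ 2)) := by
  induction q using Polynomial.induction_on' with
  | add p q hp hq =>
    exact (hp.add hq).congr (.of_forall fun x => by simp [add_mul])
  | monomial n a =>
    have h := (integrable_rpow_mul_exp_neg_mul_sq (b := 1) one_pos (s := n)
      (by have : (0 : ℝ) ≤ n := n.cast_nonneg
          linarith)).const_mul a
    simpa only [eval_monomial, Real.rpow_natCast, neg_mul, one_mul, mul_assoc] using h

/-- The functional `q ↦ ∫ q(x) e^{-x²} dx` on real polynomials. -/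
noncomputable def gaussianFunctional : ℝ[X] →ₗ[ℝ] ℝ where
  toFun q := ∫ x : ℝ, q.eval x * Real.exp (-x ^ 2)
  map_add' p q := by
    simp only [eval_add, add_mul]
    exact integral_add (integrable_eval_mul_gaussian p) (integrable_eval_mul_gaussian q)
  map_smul' a q := by
    simp only [eval_smul, smul_eq_mul, mul_assoc, RingHom.id_apply]
    exact integral_const_mul _ _

theorem gaussianFunctional_apply (q : ℝ[X]) :
    gaussianFunctional q = ∫ x : ℝ, q.eval x * Real.exp (-x ^ 2) := rfl

theorem gaussianFunctional_C_mul (a : ℝ) (q : ℝ[X]) :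
    gaussianFunctional (C a * q) = a * gaussianFunctional q := by
  rw [← smul_eq_C_mul, map_smul, smul_eq_mul]

theorem gaussianFunctional_mul_self_pos {q : ℝ[X]} (hq : q ≠ 0) :
    0 < gaussianFunctional (q * q) := by
  obtain ⟨x, hx⟩ : ∃ x, q.eval x ≠ 0 := by
    by_contra! h
    exact hq (Polynomial.funext (by simpa using h))
  refine integral_pos_of_integrable_nonneg_nonzero (x := x) ?_
    (integrable_eval_mul_gaussian _) ?_ ?_
  · exact (q * q).continuous.mul (by fun_prop)
  · intro y
    simp only [eval_mul, Pi.zero_apply]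
    exact mul_nonneg (mul_self_nonneg _) (Real.exp_pos _).le
  · simp [hx]

/-- Integration by parts: `(q e^{-x²})'` has integral zero. -/
theorem gaussianFunctional_derivative (q : ℝ[X]) :
    gaussianFunctional (derivative q) = 2 * gaussianFunctional (X * q) := by
  have hd : ∀ x : ℝ, HasDerivAt (fun x => q.eval x * Real.exp (-x ^ 2))
      ((derivative q - C 2 * (X * q)).eval x * Real.exp (-x ^ 2)) x := fun x => by
    have h := (q.hasDerivAt x).mul (((hasDerivAt_pow 2 x).neg).exp)
    refine h.congr_deriv ?_
    simp
    ring
  have h : gaussianFunctional (derivative q - C 2 * (X * q)) = 0 :=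
    integral_eq_zero_of_hasDerivAt_of_integrable hd (integrable_eval_mul_gaussian _)
      (integrable_eval_mul_gaussian _)
  rw [map_sub, gaussianFunctional_C_mul] at h
  linarith

/-- The functional of the weight `e^{-x²} (x - t)^m`. -/
noncomputable def perturbedFunctional (m : ℕ) (t : ℝ) : ℝ[X] →ₗ[ℝ] ℝ :=
  gaussianFunctional ∘ₗ LinearMap.mulRight ℝ ((X - C t) ^ m)

theorem perturbedFunctional_apply (m : ℕ) (t : ℝ) (q : ℝ[X]) :
    perturbedFunctional m t q = gaussianFunctional (q * (X - C t) ^ m) := rfl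

theorem perturbedFunctional_mul_self_pos {m : ℕ} (hm : Even m) (t : ℝ) {q : ℝ[X]} (hq : q ≠ 0) :
    0 < perturbedFunctional m t (q * q) := by
  obtain ⟨k, rfl⟩ := hm
  have h := gaussianFunctional_mul_self_pos
    (mul_ne_zero hq (pow_ne_zero k (X_sub_C_ne_zero t)))
  rw [perturbedFunctional_apply]
  convert h using 2
  ring

theorem hasDerivAt_perturbedFunctional (m : ℕ) (q : ℝ[X]) (t : ℝ) :
    HasDerivAt (fun s => perturbedFunctional (m + 1) s q)
      (-((m + 1 : ℕ) : ℝ) * perturbedFunctional m t q) t := by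
  induction m generalizing q with
  | zero =>
    have h : (fun s => perturbedFunctional (0 + 1) s q) =
        fun s => gaussianFunctional (X * q) - s * gaussianFunctional q := by
      funext s
      rw [perturbedFunctional_apply, ← gaussianFunctional_C_mul, ← map_sub]
      congr 1
      ring
    rw [h]
    refine (((hasDerivAt_id t).mul_const (gaussianFunctional q)).const_sub _).congr_deriv ?_
    simp [perturbedFunctional_apply]
  | succ m ih =>
    have h : (fun s => perturbedFunctional (m + 1 + 1) s q) =
        fun s => perturbedFunctional (m + 1) s (X * q) - s * perturbedFunctional (m + 1) s q := by
      funext s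
      simp only [perturbedFunctional_apply]
      rw [← gaussianFunctional_C_mul, ← map_sub]
      congr 1
      ring
    have h' : perturbedFunctional (m + 1) t q =
        perturbedFunctional m t (X * q) - t * perturbedFunctional m t q := by
      simp only [perturbedFunctional_apply]
      rw [← gaussianFunctional_C_mul, ← map_sub]
      congr 1
      ring
    rw [h]
    refine ((ih (X * q)).sub ((hasDerivAt_id t).mul (ih q))).congr_deriv ?_
    simp only [id]
    push_cast
    linear_combination (m + 1 : ℝ) * h'

/-! ### Monic orthogonal polynomials of a positive functional -/

/-- A polynomial is a linear combination of lower-degree monic `p k`, so orthogonality to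
these passes to it. -/
theorem functional_mul_eq_zero_of_degree_lt (L : ℝ[X] →ₗ[ℝ] ℝ) {p : ℕ → ℝ[X]}
    (hp : ∀ n, (p n).Monic) (hdeg : ∀ n, (p n).natDegree = n) {f : ℝ[X]} {n : ℕ}
    (h : ∀ k < n, L (f * p k) = 0) {q : ℝ[X]} (hq : q.degree < n) : L (f * q) = 0 := by
  induction n generalizing q with
  | zero =>
    rw [show q = 0 by simpa [Nat.WithBot.lt_zero_iff] using hq, mul_zero, map_zero]
  | succ n ih =>
    have hr : (q - C (q.coeff n) * p n).degree < n := by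
      rw [degree_lt_iff_coeff_zero]
      intro k hk
      rcases hk.eq_or_lt with rfl | hk
      · have : (p n).coeff n = 1 := by simpa [hdeg n] using (hp n).coeff_natDegree
        simp [this]
      · rw [coeff_sub, coeff_C_mul, (degree_lt_iff_coeff_zero q (n + 1)).1 hq k hk,
          coeff_eq_zero_of_natDegree_lt (p := p n) (by rwa [hdeg])]
        simp
    have h1 := ih (fun k hk => h k (hk.trans n.lt_succ_self)) hr
    have h2 : f * q = f * (q - C (q.coeff n) * p n) + q.coeff n • (f * p n) := by
      rw [smul_eq_C_mul]
      ring
    rw [h2, map_add, map_smul, h1, h n n.lt_succ_self, smul_zero, add_zero]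

theorem degree_sub_lt_of_monic {p q : ℝ[X]} {n : ℕ} (hp : p.Monic) (hq : q.Monic)
    (hpn : p.natDegree = n) (hqn : q.natDegree = n) : (p - q).degree < n := by
  have h : p.degree = n := by rw [degree_eq_natDegree hp.ne_zero, hpn]
  rw [← h]
  exact degree_sub_lt_left (by rw [h, degree_eq_natDegree hq.ne_zero, hqn]) hp.ne_zero
    (by rw [hp.leadingCoeff, hq.leadingCoeff])

/-- The diagonal recurrence coefficient `⟨X p, p⟩ / ⟨p, p⟩`. -/
noncomputable def recurrenceDiag (L : ℝ[X] →ₗ[ℝ] ℝ) (p : ℝ[X]) : ℝ :=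
  L (X * p * p) / L (p * p)

/-- The monic orthogonal polynomials of a functional, built by their three-term recurrence. -/
noncomputable def monicOrthogonal (L : ℝ[X] →ₗ[ℝ] ℝ) : ℕ → ℝ[X]
  | 0 => 1
  | 1 => X - C (recurrenceDiag L 1)
  | n + 2 =>
    (X - C (recurrenceDiag L (monicOrthogonal L (n + 1)))) * monicOrthogonal L (n + 1) -
      C (L (monicOrthogonal L (n + 1) * monicOrthogonal L (n + 1)) /
        L (monicOrthogonal L n * monicOrthogonal L n)) * monicOrthogonal L n

section

variable (L : ℝ[X] →ₗ[ℝ] ℝ)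

theorem monicOrthogonal_monic_natDegree (n : ℕ) :
    (monicOrthogonal L n).Monic ∧ (monicOrthogonal L n).natDegree = n := by
  induction n using Nat.twoStepInduction with
  | zero => exact ⟨monic_one, natDegree_one⟩
  | one => exact ⟨monic_X_sub_C _, natDegree_X_sub_C _⟩
  | more n ih0 ih1 =>
    have hm : ((X - C (recurrenceDiag L (monicOrthogonal L (n + 1)))) *
        monicOrthogonal L (n + 1)).Monic := (monic_X_sub_C _).mul ih1.1
    have hd : ((X - C (recurrenceDiag L (monicOrthogonal L (n + 1)))) *
        monicOrthogonal L (n + 1)).natDegree = n + 2 := by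
      rw [(monic_X_sub_C _).natDegree_mul ih1.1, natDegree_X_sub_C, ih1.2]
      ring
    have hlt : (C (L (monicOrthogonal L (n + 1) * monicOrthogonal L (n + 1)) /
        L (monicOrthogonal L n * monicOrthogonal L n)) * monicOrthogonal L n).degree <
        ((X - C (recurrenceDiag L (monicOrthogonal L (n + 1)))) *
          monicOrthogonal L (n + 1)).degree := by
      rw [← smul_eq_C_mul]
      refine (degree_smul_le _ _).trans_lt ?_
      rw [degree_eq_natDegree ih0.1.ne_zero, degree_eq_natDegree hm.ne_zero, ih0.2, hd]
      exact_mod_cast (by omega : n < n + 2)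
    refine ⟨hm.sub_of_left hlt, ?_⟩
    rw [monicOrthogonal, natDegree_eq_of_degree_eq (degree_sub_eq_left_of_degree_lt hlt), hd]

end

theorem monicOrthogonal_mul_eq_zero {L : ℝ[X] →ₗ[ℝ] ℝ} (hL : ∀ q : ℝ[X], q ≠ 0 → 0 < L (q * q))
    (n : ℕ) : ∀ k < n, L (monicOrthogonal L n * monicOrthogonal L k) = 0 := by
  have hmon := fun n => (monicOrthogonal_monic_natDegree L n).1
  have hdeg := fun n => (monicOrthogonal_monic_natDegree L n).2
  have hne : ∀ n, L (monicOrthogonal L n * monicOrthogonal L n) ≠ 0 := fun n =>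
    (hL _ (hmon n).ne_zero).ne'
  induction n using Nat.twoStepInduction with
  | zero => simp
  | one =>
    intro k hk
    obtain rfl : k = 0 := by omega
    have h1 : monicOrthogonal L 1 * monicOrthogonal L 0 =
        X * 1 * 1 - recurrenceDiag L 1 • ((1 : ℝ[X]) * 1) := by
      simp only [monicOrthogonal, smul_eq_C_mul]
      ring
    have h0 : L ((1 : ℝ[X]) * 1) ≠ 0 := hne 0
    rw [h1, map_sub, map_smul, smul_eq_mul, recurrenceDiag, div_mul_cancel₀ _ h0, sub_self]
  | more n ih0 ih1 =>
    intro k hk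
    have hlow : ∀ q : ℝ[X], q.degree < (n + 1 : ℕ) → L (monicOrthogonal L (n + 1) * q) = 0 :=
      fun q hq => functional_mul_eq_zero_of_degree_lt L hmon hdeg ih1 hq
    have hexp : L (monicOrthogonal L (n + 2) * monicOrthogonal L k) =
        L (monicOrthogonal L (n + 1) * (X * monicOrthogonal L k)) -
          recurrenceDiag L (monicOrthogonal L (n + 1)) *
            L (monicOrthogonal L (n + 1) * monicOrthogonal L k) -
          L (monicOrthogonal L (n + 1) * monicOrthogonal L (n + 1)) /
            L (monicOrthogonal L n * monicOrthogonal L n) *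
            L (monicOrthogonal L n * monicOrthogonal L k) := by
      have h : monicOrthogonal L (n + 2) * monicOrthogonal L k =
          monicOrthogonal L (n + 1) * (X * monicOrthogonal L k) -
            recurrenceDiag L (monicOrthogonal L (n + 1)) •
              (monicOrthogonal L (n + 1) * monicOrthogonal L k) -
            (L (monicOrthogonal L (n + 1) * monicOrthogonal L (n + 1)) /
              L (monicOrthogonal L n * monicOrthogonal L n)) •
              (monicOrthogonal L n * monicOrthogonal L k) := by
        rw [monicOrthogonal, smul_eq_C_mul, smul_eq_C_mul]
        ring
      rw [h, map_sub, map_sub, map_smul, map_smul, smul_eq_mul, smul_eq_mul]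
    have hXm : (X * monicOrthogonal L k).Monic := monic_X.mul (hmon k)
    have hXd : (X * monicOrthogonal L k).natDegree = k + 1 := by
      rw [natDegree_X_mul (hmon k).ne_zero, hdeg]
    rw [hexp]
    obtain rfl | rfl | hk : k = n + 1 ∨ k = n ∨ k < n := by omega
    · have h0 := ih1 n n.lt_succ_self
      rw [mul_comm (monicOrthogonal L n) (monicOrthogonal L (n + 1)), h0, recurrenceDiag, div_mul_cancel₀ _ (hne _)]
      rw [show monicOrthogonal L (n + 1) * (X * monicOrthogonal L (n + 1)) =
        X * monicOrthogonal L (n + 1) * monicOrthogonal L (n + 1) by ring]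
      simp
    · have h0 := hlow _ (degree_sub_lt_of_monic hXm (hmon (k + 1)) hXd (hdeg _))
      rw [mul_sub, map_sub] at h0
      rw [ih1 k k.lt_succ_self, div_mul_cancel₀ _ (hne _)]
      linarith
    · rw [ih1 k (by omega), ih0 k hk, hlow _ (by
        rw [degree_eq_natDegree hXm.ne_zero, hXd]
        exact_mod_cast (by omega : k + 1 < n + 1))]
      simp

/-! ### Hermite polynomials -/

/-- The monic Hermite polynomials orthogonal for `e^{-x²}`, i.e. `2^{-n}` times the physicists'
ones, given by the raising operator `q ↦ X q - q' / 2`. -/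
noncomputable def monicHermite : ℕ → ℝ[X]
  | 0 => 1
  | n + 1 => X * monicHermite n - C (1 / 2) * derivative (monicHermite n)

theorem derivative_monicHermite_succ (n : ℕ) :
    derivative (monicHermite (n + 1)) = C (n + 1 : ℝ) * monicHermite n := by
  induction n with
  | zero => simp [monicHermite]
  | succ n ih =>
    rw [monicHermite, derivative_sub, derivative_mul, derivative_X, derivative_C_mul, ih,
      derivative_C_mul]
    rw [show monicHermite (n + 1) =
      X * monicHermite n - C (1 / 2) * derivative (monicHermite n) from rfl]
    push_cast
    simp only [map_add, map_one, map_natCast]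
    ring

/-- The three-term recurrence; at `n = 0` the last term vanishes through its coefficient. -/
theorem monicHermite_succ (n : ℕ) :
    monicHermite (n + 1) = X * monicHermite n - C (n / 2 : ℝ) * monicHermite (n - 1) := by
  cases n with
  | zero => simp [monicHermite]
  | succ n =>
    rw [monicHermite, derivative_monicHermite_succ, ← mul_assoc, ← C_mul]
    congr 3
    push_cast
    ring

theorem monicHermite_monic_natDegree (n : ℕ) :
    (monicHermite n).Monic ∧ (monicHermite n).natDegree = n := by
  induction n with
  | zero => exact ⟨monic_one, natDegree_one⟩
  | succ n ih =>
    have hm : (X * monicHermite n).Monic := monic_X.mul ih.1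
    have hd : (X * monicHermite n).natDegree = n + 1 := by
      rw [natDegree_X_mul ih.1.ne_zero, ih.2]
    have hlt : (C (1 / 2 : ℝ) * derivative (monicHermite n)).degree <
        (X * monicHermite n).degree := by
      rw [← smul_eq_C_mul]
      refine (degree_smul_le _ _).trans_lt ((degree_derivative_lt ih.1.ne_zero).trans ?_)
      rw [degree_eq_natDegree ih.1.ne_zero, degree_eq_natDegree hm.ne_zero, ih.2, hd]
      exact_mod_cast n.lt_succ_self
    refine ⟨hm.sub_of_left hlt, ?_⟩
    rw [monicHermite, natDegree_eq_of_degree_eq (degree_sub_eq_left_of_degree_lt hlt), hd]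

theorem gaussianFunctional_monicHermite_mul {n : ℕ} {q : ℝ[X]} (hq : q.degree < n) :
    gaussianFunctional (monicHermite n * q) = 0 := by
  induction n generalizing q with
  | zero =>
    rw [show q = 0 by simpa [Nat.WithBot.lt_zero_iff] using hq, mul_zero, map_zero]
  | succ n ih =>
    have hq' : (derivative q).degree < n := by
      rw [degree_lt_iff_coeff_zero] at hq ⊢
      intro k hk
      rw [coeff_derivative, hq (k + 1) (by omega), zero_mul]
    -- `⟨π (n+1), q⟩ = ⟨π n, q'⟩ / 2`: the raising operator is adjoint to half the derivative.
    have h1 := gaussianFunctional_derivative (monicHermite n * q)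
    rw [derivative_mul, map_add, ih hq', add_zero] at h1
    have h2 : monicHermite (n + 1) * q =
        X * (monicHermite n * q) - C (1 / 2) * (derivative (monicHermite n) * q) := by
      rw [monicHermite]
      ring
    rw [h2, map_sub, gaussianFunctional_C_mul, h1]
    ring

theorem gaussianFunctional_monicHermite_mul_of_ne {m n : ℕ} (h : m ≠ n) :
    gaussianFunctional (monicHermite m * monicHermite n) = 0 := by
  wlog hlt : n < m generalizing m n
  · rw [mul_comm]
    exact this h.symm (by omega)
  refine gaussianFunctional_monicHermite_mul ?_
  rw [degree_eq_natDegree (monicHermite_monic_natDegree n).1.ne_zero,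
    (monicHermite_monic_natDegree n).2]
  exact_mod_cast hlt

theorem iterate_derivative_monicHermite (s i : ℕ) :
    derivative^[i] (monicHermite s) = C (s.descFactorial i : ℝ) * monicHermite (s - i) := by
  induction i with
  | zero => simp
  | succ i ih =>
    rw [Function.iterate_succ_apply', ih, derivative_C_mul, Nat.descFactorial_succ]
    rcases Nat.eq_zero_or_pos (s - i) with h | h
    · rw [h]
      simp [monicHermite]
    · obtain ⟨k, hk⟩ := Nat.exists_eq_succ_of_ne_zero h.ne'
      rw [show s - (i + 1) = k by omega, hk, Nat.succ_eq_add_one, derivative_monicHermite_succ]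
      push_cast
      simp only [map_mul, map_add, map_one, map_natCast]
      ring

/-- A polynomial of degree below `n + m` orthogonal to all polynomials of degree below `n` is a
combination of the `m` Hermite polynomials of degrees `n, …, n + m - 1`. -/
theorem exists_eq_sum_monicHermite {n m : ℕ} {r : ℝ[X]} (hr : r.degree < (n + m : ℕ))
    (h : ∀ s : ℝ[X], s.degree < n → gaussianFunctional (r * s) = 0) :
    ∃ a : ℕ → ℝ, r = ∑ j ∈ Finset.range m, C (a j) * monicHermite (n + j) := by
  induction m generalizing r with
  | zero =>
    refine ⟨0, ?_⟩
    have h0 := h r hr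
    by_contra hne
    exact (gaussianFunctional_mul_self_pos (by simpa using hne)).ne' h0
  | succ m ih =>
    have hdeg := (monicHermite_monic_natDegree (n + m)).2
    have hcoeff : (monicHermite (n + m)).coeff (n + m) = 1 := by
      simpa [hdeg] using (monicHermite_monic_natDegree (n + m)).1.coeff_natDegree
    obtain ⟨a, ha⟩ := ih (r := r - C (r.coeff (n + m)) * monicHermite (n + m)) (by
      rw [degree_lt_iff_coeff_zero]
      intro k hk
      rcases hk.eq_or_lt with rfl | hk
      · simp [hcoeff]
      · rw [coeff_sub, coeff_C_mul, (degree_lt_iff_coeff_zero r _).1 hr k hk,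
          coeff_eq_zero_of_natDegree_lt (p := monicHermite (n + m)) (by rwa [hdeg])]
        simp) (by
      intro s hs
      rw [sub_mul, map_sub, h s hs, mul_assoc, gaussianFunctional_C_mul,
        gaussianFunctional_monicHermite_mul (hs.trans_le (by exact_mod_cast n.le_add_right m))]
      simp)
    refine ⟨Function.update a m (r.coeff (n + m)), ?_⟩
    rw [Finset.sum_range_succ, Function.update_self, Finset.sum_congr rfl fun j hj => by
      rw [Function.update_of_ne (Finset.mem_range.1 hj).ne], ← ha]
    ring

/-! ### Wronskians of Hermite polynomials and the Christoffel expansion -/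

theorem X_sub_C_pow_dvd_iff_iterate_derivative {q : ℝ[X]} {t : ℝ} {m : ℕ} :
    (X - C t) ^ m ∣ q ↔ ∀ i < m, (derivative^[i] q).eval t = 0 := by
  rcases eq_or_ne q 0 with rfl | hq
  · simp
  rw [← le_rootMultiplicity_iff hq]
  cases m with
  | zero => simp
  | succ m =>
    rw [Nat.succ_le_iff, lt_rootMultiplicity_iff_isRoot_iterate_derivative hq]
    simp only [Nat.lt_succ_iff, IsRoot]

/-- The Wronskian matrix at `t` of the monic Hermite polynomials of degrees `n, …, n + m - 1`. -/
noncomputable def hermiteWronskianMatrix (m n : ℕ) (t : ℝ) : Matrix (Fin m) (Fin m) ℝ :=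
  Matrix.of fun i j => (derivative^[(i : ℕ)] (monicHermite (n + j))).eval t

theorem differentiable_det_hermiteWronskianMatrix (m n : ℕ) :
    Differentiable ℝ fun t => (hermiteWronskianMatrix m n t).det := by
  have h : (fun t => (hermiteWronskianMatrix m n t).det) = fun t =>
      (Matrix.det (Matrix.of fun i j : Fin m =>
        derivative^[(i : ℕ)] (monicHermite (n + j)))).eval t := by
    funext t
    rw [← coe_evalRingHom, RingHom.map_det]
    rfl
  rw [h]
  exact Polynomial.differentiable _

theorem hermiteWronskianMatrix_mulVec (m n : ℕ) (t : ℝ) (a : ℕ → ℝ) (i : Fin m) :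
    (hermiteWronskianMatrix m n t).mulVec (fun j => a j) i =
      (derivative^[(i : ℕ)]
        (∑ j ∈ Finset.range m, C (a j) * monicHermite (n + j))).eval t := by
  rw [iterate_derivative_sum, eval_finsetSum, Finset.sum_range, Matrix.mulVec, dotProduct]
  refine Finset.sum_congr rfl fun j _ => ?_
  rw [iterate_derivative_C_mul, eval_C_mul, mul_comm]
  rfl

theorem gaussianFunctional_sum_mul (s : Finset ℕ) (a : ℕ → ℝ) (f : ℕ → ℝ[X]) (q : ℝ[X]) :
    gaussianFunctional ((∑ j ∈ s, C (a j) * f j) * q) =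
      ∑ j ∈ s, a j * gaussianFunctional (f j * q) := by
  rw [Finset.sum_mul, map_sum]
  exact Finset.sum_congr rfl fun j _ => by rw [mul_assoc, gaussianFunctional_C_mul]

/-- A kernel vector gives a combination of Hermite polynomials of the form `(X - t)^m r` with
`deg r < n`; it is orthogonal to `r`, so `∫ r² (x - t)^m e^{-x²} = 0` and `r = 0`. -/
theorem det_hermiteWronskianMatrix_ne_zero {m : ℕ} (hm : Even m) (n : ℕ) (t : ℝ) :
    (hermiteWronskianMatrix m n t).det ≠ 0 := by
  intro hdet
  obtain ⟨v, hv, hker⟩ := Matrix.exists_mulVec_eq_zero_iff.2 hdet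
  let a : ℕ → ℝ := fun j => if h : j < m then v ⟨j, h⟩ else 0
  have hav : (fun j : Fin m => a j) = v := by
    funext j
    simp [a]
  set q : ℝ[X] := ∑ j ∈ Finset.range m, C (a j) * monicHermite (n + j) with hq
  obtain ⟨r, hr⟩ : (X - C t) ^ m ∣ q := by
    rw [X_sub_C_pow_dvd_iff_iterate_derivative]
    intro i hi
    rw [hq, ← hermiteWronskianMatrix_mulVec m n t a ⟨i, hi⟩, hav, hker]
    rfl
  have hqdeg : q.degree < (n + m : ℕ) := by
    refine (degree_sum_le _ _).trans_lt ((Finset.sup_lt_iff (WithBot.bot_lt_coe _)).2 ?_)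
    intro j hj
    rw [← smul_eq_C_mul]
    refine (degree_smul_le _ _).trans_lt ?_
    rw [degree_eq_natDegree (monicHermite_monic_natDegree _).1.ne_zero,
      (monicHermite_monic_natDegree _).2]
    exact_mod_cast Nat.add_lt_add_left (Finset.mem_range.1 hj) n
  have hr0 : r = 0 := by
    by_contra hr0
    have hrdeg : r.degree < n := by
      have hmon : ((X - C t) ^ m).Monic := (monic_X_sub_C t).pow m
      rw [hr, degree_mul, degree_eq_natDegree hmon.ne_zero,
        (monic_X_sub_C t).natDegree_pow, natDegree_X_sub_C, degree_eq_natDegree hr0] at hqdeg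
      rw [degree_eq_natDegree hr0]
      norm_cast at hqdeg ⊢
      omega
    have h1 : gaussianFunctional (q * r) = 0 := by
      rw [hq, gaussianFunctional_sum_mul]
      refine Finset.sum_eq_zero fun j _ => ?_
      rw [gaussianFunctional_monicHermite_mul
        (hrdeg.trans_le (by exact_mod_cast n.le_add_right j)), mul_zero]
    have h2 := perturbedFunctional_mul_self_pos hm t hr0
    rw [perturbedFunctional_apply, show r * r * (X - C t) ^ m = q * r by rw [hr]; ring, h1] at h2
    exact h2.false
  have hq0 : q = 0 := by rw [hr, hr0, mul_zero]
  apply hv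
  funext k
  have h1 : gaussianFunctional (q * monicHermite (n + k)) = 0 := by rw [hq0, zero_mul, map_zero]
  rw [hq, gaussianFunctional_sum_mul, Finset.sum_eq_single (k : ℕ)] at h1
  · have h2 := gaussianFunctional_mul_self_pos (monicHermite_monic_natDegree (n + k)).1.ne_zero
    rw [← hav]
    exact (mul_eq_zero.1 h1).resolve_right h2.ne'
  · intro j _ hj
    rw [gaussianFunctional_monicHermite_mul_of_ne (by omega), mul_zero]
  · intro hk
    exact absurd (Finset.mem_range.2 k.2) hk

/-- Cramer's rule for the lowest coefficient, when the Wronskian system of even size expresses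
the next Hermite polynomial: cyclically shifting the columns costs a sign which cancels. -/
theorem det_hermiteWronskianMatrix_succ {m : ℕ} (hm : Even m) (hm0 : 0 < m) (n : ℕ) (t : ℝ)
    (a : ℕ → ℝ)
    (h : ∀ i < m, (derivative^[i] ((∑ j ∈ Finset.range m, C (a j) * monicHermite (n + j)) +
      monicHermite (n + m))).eval t = 0) :
    (hermiteWronskianMatrix m (n + 1) t).det = a 0 * (hermiteWronskianMatrix m n t).det := by
  obtain ⟨k, rfl⟩ : ∃ k, m = k + 1 := ⟨m - 1, by omega⟩
  set W := hermiteWronskianMatrix (k + 1) n t with hW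
  let v : Fin (k + 1) → ℝ := fun i => (derivative^[(i : ℕ)] (monicHermite (n + (k + 1)))).eval t
  have hWa : W.mulVec (fun j => a j) = -v := by
    funext i
    have hi := h i i.2
    rw [iterate_map_add, eval_add, ← hermiteWronskianMatrix_mulVec] at hi
    exact eq_neg_of_add_eq_zero_left hi
  have hcramer : a 0 * W.det = (W.updateCol 0 (-v)).det := by
    rw [← Matrix.cramer_apply, ← hWa, Matrix.cramer_eq_adjugate_mulVec, Matrix.mulVec_mulVec,
      Matrix.adjugate_mul, Matrix.smul_mulVec, Matrix.one_mulVec]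
    simp [mul_comm]
  have hshift : hermiteWronskianMatrix (k + 1) (n + 1) t =
      (W.updateCol 0 v).submatrix id (finRotate (k + 1)) := by
    ext i j
    rw [Matrix.submatrix_apply, id]
    induction j using Fin.lastCases with
    | last =>
      rw [finRotate_last, Matrix.updateCol_self]
      simp [hermiteWronskianMatrix, v, add_assoc, add_comm 1]
    | cast j =>
      have hj : finRotate (k + 1) j.castSucc = j.succ := finRotate_of_lt j.2
      rw [hj, Matrix.updateCol_ne (Fin.succ_ne_zero j)]
      simp [hermiteWronskianMatrix, hW, add_assoc, add_comm 1]
  have hodd : Odd k := by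
    rw [← Nat.not_even_iff_odd]
    intro hk
    exact (Nat.even_add_one.1 hm) hk
  have hneg : -v = (-1 : ℝ) • v := by simp
  rw [hcramer, hshift, Matrix.det_permute', sign_finRotate, hneg, Matrix.det_updateCol_smul]
  simp [hodd.neg_one_pow]

/-- If `p` is monic of degree `n` and orthogonal to lower degrees for `e^{-x²} (x - t)^m`, the
polynomial `(X - t)^m p` is a combination of the Hermite polynomials of degrees `n, …, n + m`
vanishing to order `m` at `t`; its lowest coefficient gives the squared norm of `p`. -/
theorem perturbedFunctional_mul_self_mul_det {m : ℕ} (hm : Even m) (hm0 : 0 < m) {n : ℕ} {t : ℝ}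
    {p : ℝ[X]} (hp : p.Monic) (hpn : p.natDegree = n)
    (horth : ∀ q : ℝ[X], q.degree < n → perturbedFunctional m t (p * q) = 0) :
    perturbedFunctional m t (p * p) * (hermiteWronskianMatrix m n t).det =
      gaussianFunctional (monicHermite n * monicHermite n) *
        (hermiteWronskianMatrix m (n + 1) t).det := by
  have hpow : ((X - C t) ^ m).Monic := (monic_X_sub_C t).pow m
  have hmon : ((X - C t) ^ m * p).Monic := hpow.mul hp
  have hdeg : ((X - C t) ^ m * p).natDegree = n + m := by
    rw [hpow.natDegree_mul hp, (monic_X_sub_C t).natDegree_pow, natDegree_X_sub_C, hpn]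
    ring
  obtain ⟨a, ha⟩ := exists_eq_sum_monicHermite
    (degree_sub_lt_of_monic hmon (monicHermite_monic_natDegree (n + m)).1 hdeg
      (monicHermite_monic_natDegree (n + m)).2) (by
    intro s hs
    rw [sub_mul, map_sub, gaussianFunctional_monicHermite_mul
      (hs.trans_le (by exact_mod_cast n.le_add_right m)), sub_zero, ← horth s hs,
      perturbedFunctional_apply]
    congr 1
    ring)
  rw [sub_eq_iff_eq_add] at ha
  have hsucc := det_hermiteWronskianMatrix_succ hm hm0 n t a (by
    rw [← ha, ← X_sub_C_pow_dvd_iff_iterate_derivative]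
    exact dvd_mul_right _ _)
  have hdegn : ∀ j, p.degree < (n + (j + 1) : ℕ) := fun j => by
    rw [degree_eq_natDegree hp.ne_zero, hpn]
    exact_mod_cast (by omega : n < n + (j + 1))
  have hnorm : perturbedFunctional m t (p * p) =
      a 0 * gaussianFunctional (monicHermite n * monicHermite n) := by
    have h0 : gaussianFunctional (monicHermite n * p) =
        gaussianFunctional (monicHermite n * monicHermite n) := by
      have := gaussianFunctional_monicHermite_mul (degree_sub_lt_of_monic hp
        (monicHermite_monic_natDegree n).1 hpn (monicHermite_monic_natDegree n).2)
      rw [mul_sub, map_sub] at this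
      linarith
    obtain ⟨k, rfl⟩ : ∃ k, m = k + 1 := ⟨m - 1, by omega⟩
    rw [perturbedFunctional_apply, show p * p * (X - C t) ^ (k + 1) = (X - C t) ^ (k + 1) * p * p
      by ring, ha, add_mul, map_add, gaussianFunctional_monicHermite_mul (hdegn k), add_zero,
      gaussianFunctional_sum_mul, Finset.sum_range_succ']
    rw [Finset.sum_eq_zero fun j _ => by
      rw [gaussianFunctional_monicHermite_mul (hdegn j), mul_zero], zero_add, add_zero, h0]
  rw [hnorm, hsucc]
  ring

/-! ### The polynomials `P_s` as rescaled Hermite polynomials -/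

theorem coeff_schurP (s : ℤ) (i j : ℕ) (h : (i : ℤ) + 2 * j = s) :
    (schurP s).coeff i = 1 / ((6 : ℂ) ^ j * i.factorial * j.factorial) := by
  rw [schurP, finsetSum_coeff, Finset.sum_eq_single (i, j)]
  · rw [coeff_C_mul, coeff_X_pow, if_pos rfl, mul_one]
  · rintro ⟨k, l⟩ hkl hne
    rw [Finset.mem_filter] at hkl
    have hki : k ≠ i := by
      rintro rfl
      refine hne (Prod.ext rfl ?_)
      have := hkl.2
      simp only at this ⊢
      omega
    rw [coeff_C_mul, coeff_X_pow, if_neg hki.symm, mul_zero]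
  · intro hn
    refine absurd ?_ hn
    simp only [Finset.mem_filter, Finset.mem_product, Finset.mem_range]
    omega

theorem coeff_schurP_eq_zero (s : ℤ) (i : ℕ) (h : ∀ j : ℕ, (i : ℤ) + 2 * j ≠ s) :
    (schurP s).coeff i = 0 := by
  rw [schurP, finsetSum_coeff]
  refine Finset.sum_eq_zero ?_
  rintro ⟨k, l⟩ hkl
  rw [Finset.mem_filter] at hkl
  have hki : k ≠ i := by
    rintro rfl
    exact h l hkl.2
  rw [coeff_C_mul, coeff_X_pow, if_neg hki.symm, mul_zero]

theorem schurP_of_neg {s : ℤ} (hs : s < 0) : schurP s = 0 := by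
  ext i
  rw [coeff_schurP_eq_zero s i (fun j => by omega), coeff_zero]

theorem schurP_zero : schurP 0 = 1 := by
  ext i
  rw [coeff_one]
  split_ifs with h
  · rw [coeff_schurP 0 i 0 (by omega), h]
    simp
  · exact coeff_schurP_eq_zero 0 i (fun j => by omega)

/-- The recurrence given by differentiating the generating function `exp (x z + z² / 6)`
in `z`. -/
theorem schurP_recurrence (s : ℤ) :
    C (s + 1 : ℂ) * schurP (s + 1) = X * schurP s + C (1 / 3) * schurP (s - 1) := by
  have hcast : ∀ i j : ℕ, (i : ℤ) + 2 * j = s + 1 → (s : ℂ) + 1 = i + 2 * j := fun i j h => by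
    exact_mod_cast h.symm
  ext i
  rw [coeff_add, coeff_C_mul, coeff_C_mul]
  by_cases h : ∃ j : ℕ, (i : ℤ) + 2 * j = s + 1
  · obtain ⟨j, hj⟩ := h
    rw [coeff_schurP _ i j hj, hcast i j hj]
    have h6 : (6 : ℂ) ^ j ≠ 0 := by simp
    have hi : (i.factorial : ℂ) ≠ 0 := by exact_mod_cast i.factorial_ne_zero
    have hX : (X * schurP s).coeff i = i / ((6 : ℂ) ^ j * i.factorial * j.factorial) := by
      cases i with
      | zero => simp
      | succ i =>
        rw [coeff_X_mul, coeff_schurP s i j (by push_cast at hj; linarith), Nat.factorial_succ]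
        have hi : (i.factorial : ℂ) ≠ 0 := by exact_mod_cast i.factorial_ne_zero
        have hj : (j.factorial : ℂ) ≠ 0 := by exact_mod_cast j.factorial_ne_zero
        have hi1 : (i : ℂ) + 1 ≠ 0 := by exact_mod_cast i.succ_ne_zero
        push_cast
        field_simp
    have hP : 1 / 3 * (schurP (s - 1)).coeff i =
        2 * j / ((6 : ℂ) ^ j * i.factorial * j.factorial) := by
      cases j with
      | zero =>
        rw [coeff_schurP_eq_zero _ _ (fun l => by push_cast at hj; omega)]
        simp
      | succ j =>
        rw [coeff_schurP (s - 1) i j (by push_cast at hj; linarith), Nat.factorial_succ]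
        have hj : (j.factorial : ℂ) ≠ 0 := by exact_mod_cast j.factorial_ne_zero
        have hj1 : (j : ℂ) + 1 ≠ 0 := by exact_mod_cast j.succ_ne_zero
        push_cast
        field_simp
        ring
    rw [hX, hP]
    ring
  · push Not at h
    rw [coeff_schurP_eq_zero _ _ h, coeff_schurP_eq_zero (s - 1) i (fun j hj =>
      h (j + 1) (by push_cast; linarith))]
    cases i with
    | zero => simp
    | succ i =>
      rw [coeff_X_mul, coeff_schurP_eq_zero s i (fun j hj => h j (by push_cast; linarith))]
      simp

/-- `π_s(t) = s! c^s P_s(t / c)` when `c² = -3/2`. -/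
theorem monicHermite_eval_eq_schurP {c : ℂ} (hc : c ^ 2 = -(3 / 2)) (t : ℝ) (s : ℕ) :
    (((monicHermite s).eval t : ℝ) : ℂ) =
      s.factorial * c ^ s * (schurP s).eval ((t : ℂ) / c) := by
  have hc0 : c ≠ 0 := by
    rintro rfl
    norm_num at hc
  have hrec : ∀ s : ℕ, ((s : ℂ) + 1) * (schurP (s + 1 : ℕ)).eval ((t : ℂ) / c) =
      (t : ℂ) / c * (schurP s).eval ((t : ℂ) / c) +
        1 / 3 * (schurP (s - 1 : ℤ)).eval ((t : ℂ) / c) := fun s => by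
    have h := congrArg (eval ((t : ℂ) / c)) (schurP_recurrence s)
    rw [eval_add, eval_C_mul, eval_C_mul, eval_mul, eval_X] at h
    exact_mod_cast h
  induction s using Nat.twoStepInduction with
  | zero => simp [monicHermite, schurP_zero]
  | one =>
    have h := hrec 0
    rw [schurP_of_neg (s := ((0 : ℕ) : ℤ) - 1) (by simp)] at h
    simp only [Nat.cast_zero, schurP_zero, eval_one, eval_zero, zero_add, one_mul, mul_one,
      mul_zero, add_zero] at h
    rw [h]
    simp [monicHermite, mul_div_cancel₀ _ hc0]
  | more s ih0 ih1 =>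
    have h := hrec (s + 1)
    rw [show (((s + 1 : ℕ) : ℤ) - 1) = (s : ℤ) by push_cast; ring] at h
    rw [monicHermite_succ, Nat.add_sub_cancel, eval_sub, eval_mul, eval_C_mul, eval_X]
    push_cast at h ih1 ⊢
    rw [show (s : ℤ) + 1 + 1 = s + 2 by ring] at h
    rw [ih0, ih1, Nat.factorial_succ (s + 1), Nat.factorial_succ s]
    push_cast
    have ht : (t : ℂ) = c * (t / c) := by field_simp
    generalize (t : ℂ) / c = x at *
    rw [ht]
    linear_combination (-(s + 1) * s.factorial * c ^ (s + 2) : ℂ) * h -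
      ((s + 1) * s.factorial * c ^ s * eval x (schurP s) / 3 : ℂ) * hc

/-- `π_s^{(i)}(t) = s! c^{s-i} P_{s-i}(t / c)`, with both sides zero for `i > s`. -/
theorem iterate_derivative_monicHermite_eval_eq_schurP {c : ℂ} (hc : c ^ 2 = -(3 / 2)) (t : ℝ)
    (s i : ℕ) :
    (((derivative^[i] (monicHermite s)).eval t : ℝ) : ℂ) =
      s.factorial * c ^ s * (c⁻¹ ^ i * (schurP ((s : ℤ) - i)).eval ((t : ℂ) / c)) := by
  have hc0 : c ≠ 0 := by
    rintro rfl
    norm_num at hc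
  rw [iterate_derivative_monicHermite, eval_C_mul, Complex.ofReal_mul,
    monicHermite_eval_eq_schurP hc]
  rcases le_or_gt i s with h | h
  · obtain ⟨k, rfl⟩ := Nat.exists_eq_add_of_le h
    rw [← Nat.factorial_mul_descFactorial h, Nat.add_sub_cancel_left,
      show ((i + k : ℕ) : ℤ) - i = k by push_cast; ring, pow_add, inv_pow]
    push_cast
    field_simp
  · rw [Nat.descFactorial_of_lt h, schurP_of_neg (s := (s : ℤ) - i) (by omega)]
    simp

theorem det_hermiteWronskianMatrix_eq_genHermite {c : ℂ} (hc : c ^ 2 = -(3 / 2)) (m n : ℕ) :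
    ∃ κ : ℂ, κ ≠ 0 ∧ ∀ t : ℝ, ((hermiteWronskianMatrix m n t).det : ℂ) =
      κ * (genHermite m n).eval ((t : ℂ) / c) := by
  have hc0 : c ≠ 0 := by
    rintro rfl
    norm_num at hc
  refine ⟨(∏ j : Fin m, ((n + j).factorial * c ^ (n + j : ℕ) : ℂ)) * ∏ i : Fin m, c⁻¹ ^ (i : ℕ),
    mul_ne_zero ?_ ?_, fun t => ?_⟩
  · exact Finset.prod_ne_zero_iff.2 fun j _ =>
      mul_ne_zero (by exact_mod_cast (n + j).factorial_ne_zero) (pow_ne_zero _ hc0)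
  · exact Finset.prod_ne_zero_iff.2 fun i _ => pow_ne_zero _ (inv_ne_zero hc0)
  · rw [← Complex.ofRealHom_eq_coe, RingHom.map_det, genHermite, ← coe_evalRingHom,
      RingHom.map_det, mul_assoc, ← Matrix.det_mul_column, ← Matrix.det_mul_row]
    congr 1
    ext i j
    simp only [RingHom.mapMatrix_apply, Matrix.map_apply, hermiteWronskianMatrix, Matrix.of_apply,
      Complex.ofRealHom_eq_coe, coe_evalRingHom]
    rw [iterate_derivative_monicHermite_eval_eq_schurP hc,
      show ((n + j : ℕ) : ℤ) - (i : ℕ) = (n : ℤ) - (i : ℕ) + (j : ℕ) by push_cast; ring]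

/-! ### The squared norms as functions of `t` -/

theorem integral_eq_perturbedFunctional (K : ℕ) (t : ℝ) (p q : ℝ[X]) :
    ∫ x : ℝ, p.eval x * q.eval x * perturbedHermiteWeight K t x =
      perturbedFunctional (2 * K) t (p * q) := by
  rw [perturbedFunctional_apply, gaussianFunctional_apply]
  refine integral_congr_ae (.of_forall fun x => ?_)
  simp only [perturbedHermiteWeight, eval_mul, eval_pow, eval_sub, eval_X, eval_C]
  ring

theorem isMonicOrthogonalSequence_monicOrthogonal (K : ℕ) (t : ℝ) :
    IsMonicOrthogonalSequence (perturbedHermiteWeight K t)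
      (monicOrthogonal (perturbedFunctional (2 * K) t)) where
  monic n := (monicOrthogonal_monic_natDegree _ n).1
  natDegree_eq n := (monicOrthogonal_monic_natDegree _ n).2
  integrable m n := by
    refine (integrable_eval_mul_gaussian
      (monicOrthogonal (perturbedFunctional (2 * K) t) m *
        monicOrthogonal (perturbedFunctional (2 * K) t) n * (X - C t) ^ (2 * K))).congr
      (.of_forall fun x => ?_)
    simp only [perturbedHermiteWeight, eval_mul, eval_pow, eval_sub, eval_X, eval_C]
    ring
  orthogonal m n h := by
    have hL := fun q (hq : q ≠ 0) =>
      perturbedFunctional_mul_self_pos (m := 2 * K) (even_two_mul K) t hq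
    rw [integral_eq_perturbedFunctional]
    rcases lt_or_gt_of_ne h with h | h
    · rw [mul_comm (monicOrthogonal _ m)]
      exact monicOrthogonal_mul_eq_zero hL n m h
    · exact monicOrthogonal_mul_eq_zero hL m n h
  norm_sq_pos n := by
    rw [integral_eq_perturbedFunctional]
    exact perturbedFunctional_mul_self_pos (even_two_mul K) t
      (monicOrthogonal_monic_natDegree _ n).1.ne_zero

theorem exists_hasRecurrenceCoefficients_monicOrthogonal (L : ℝ[X] →ₗ[ℝ] ℝ) :
    ∃ α β : ℕ → ℝ, HasRecurrenceCoefficients (monicOrthogonal L) α β := by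
  refine ⟨fun n => recurrenceDiag L (monicOrthogonal L n),
    fun n => L (monicOrthogonal L n * monicOrthogonal L n) /
      L (monicOrthogonal L (n - 1) * monicOrthogonal L (n - 1)), ⟨?_, fun n => ?_⟩⟩
  · simp only [monicOrthogonal]
    ring
  · simp only [monicOrthogonal, Nat.add_sub_cancel]
    ring

theorem IsMonicOrthogonalSequence.perturbedFunctional_mul_eq_zero {K : ℕ} {t : ℝ} {p : ℕ → ℝ[X]}
    (hp : IsMonicOrthogonalSequence (perturbedHermiteWeight K t) p) {n : ℕ} {q : ℝ[X]}
    (hq : q.degree < n) : perturbedFunctional (2 * K) t (p n * q) = 0 :=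
  functional_mul_eq_zero_of_degree_lt _ hp.monic hp.natDegree_eq (fun k hk => by
    rw [← integral_eq_perturbedFunctional, hp.orthogonal n k hk.ne']) hq

theorem HasRecurrenceCoefficients.perturbedFunctional_X_mul {K : ℕ} {t : ℝ} {p : ℕ → ℝ[X]}
    {α β : ℕ → ℝ} (h : HasRecurrenceCoefficients p α β)
    (hp : IsMonicOrthogonalSequence (perturbedHermiteWeight K t) p) (n : ℕ) :
    perturbedFunctional (2 * K) t (X * (p n * p n)) =
      α n * perturbedFunctional (2 * K) t (p n * p n) := by
  have horth : ∀ m n, m ≠ n → perturbedFunctional (2 * K) t (p m * p n) = 0 := fun m n hmn => by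
    rw [← integral_eq_perturbedFunctional, hp.orthogonal m n hmn]
  rw [← mul_assoc]
  cases n with
  | zero =>
    rw [h.zero, add_mul, map_add, horth 1 0 one_ne_zero, mul_assoc, ← smul_eq_C_mul, map_smul,
      zero_add, smul_eq_mul]
  | succ n =>
    rw [h.succ, add_mul, add_mul, map_add, map_add, horth (n + 2) (n + 1) (by omega), mul_assoc,
      mul_assoc, ← smul_eq_C_mul, ← smul_eq_C_mul, map_smul, map_smul, horth n (n + 1) (by omega),
      zero_add, smul_zero, add_zero, smul_eq_mul]

/-- Among monic polynomials of degree `n` the orthogonal one has the least squared norm. -/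
theorem perturbedFunctional_mul_self_le {m : ℕ} (hm : Even m) {n : ℕ} {t : ℝ} {p q : ℝ[X]}
    (hp : p.Monic) (hpn : p.natDegree = n) (hq : q.Monic) (hqn : q.natDegree = n)
    (horth : ∀ r : ℝ[X], r.degree < n → perturbedFunctional m t (p * r) = 0) :
    perturbedFunctional m t (p * p) ≤ perturbedFunctional m t (q * q) := by
  have h0 := horth _ (degree_sub_lt_of_monic hq hp hqn hpn)
  have h1 : 0 ≤ perturbedFunctional m t ((q - p) * (q - p)) := by
    rcases eq_or_ne (q - p) 0 with h | h
    · rw [h, mul_zero, map_zero]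
    · exact (perturbedFunctional_mul_self_pos hm t h).le
  have h2 : q * q = p * p + (2 : ℝ) • (p * (q - p)) + (q - p) * (q - p) := by
    rw [smul_eq_C_mul, C_ofNat]
    ring
  rw [h2, map_add, map_add, map_smul, h0, smul_zero, add_zero]
  linarith

/-- With `p` fixed, `∂ₜ ∫ p² w = -2 ∫ x p² w`: integrate by parts, using
`(∂ₜ + ∂ₓ) w = -2 x w` and `p ⟂ p'`. -/
theorem hasDerivAt_perturbedFunctional_mul_self {m : ℕ} (hm0 : 0 < m) {n : ℕ} {t : ℝ} {p : ℝ[X]}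
    (hp : p.Monic) (hpn : p.natDegree = n)
    (horth : ∀ q : ℝ[X], q.degree < n → perturbedFunctional m t (p * q) = 0) :
    HasDerivAt (fun s => perturbedFunctional m s (p * p))
      (-2 * perturbedFunctional m t (X * (p * p))) t := by
  obtain ⟨k, rfl⟩ : ∃ k, m = k + 1 := ⟨m - 1, by omega⟩
  refine (hasDerivAt_perturbedFunctional k (p * p) t).congr_deriv ?_
  have hd : (derivative p).degree < n := by
    rw [← hpn, ← degree_eq_natDegree hp.ne_zero]
    exact degree_derivative_lt hp.ne_zero
  have h0 := horth _ hd
  have h1 := gaussianFunctional_derivative (p * p * (X - C t) ^ (k + 1))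
  have h2 : derivative (p * p * (X - C t) ^ (k + 1)) =
      C 2 * (p * derivative p * (X - C t) ^ (k + 1)) +
        C ((k + 1 : ℕ) : ℝ) * (p * p * (X - C t) ^ k) := by
    rw [derivative_mul, derivative_mul, derivative_X_sub_C_pow, Nat.add_sub_cancel, C_ofNat]
    simp only [Nat.cast_add, Nat.cast_one, map_add, map_natCast, map_one]
    ring
  rw [h2, map_add, gaussianFunctional_C_mul, gaussianFunctional_C_mul] at h1
  simp only [perturbedFunctional_apply, mul_assoc] at h0 h1 ⊢
  rw [h0] at h1
  linarith

/-- The Wronskian quotient equals the squared norm for every parameter, so near `t` it is below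
the squared norm of the fixed polynomial `p n`, with equality at `t`; the two functions have the
same derivative there. -/
theorem hasDerivAt_hermiteWronskian_quotient {K : ℕ} (hK : 0 < K) {t : ℝ} {p : ℕ → ℝ[X]}
    {α β : ℕ → ℝ} (hp : IsMonicOrthogonalSequence (perturbedHermiteWeight K t) p)
    (h : HasRecurrenceCoefficients p α β) (n : ℕ) :
    HasDerivAt
      (fun s => gaussianFunctional (monicHermite n * monicHermite n) *
        (hermiteWronskianMatrix (2 * K) (n + 1) s).det / (hermiteWronskianMatrix (2 * K) n s).det)
      (-2 * α n * (gaussianFunctional (monicHermite n * monicHermite n) *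
        (hermiteWronskianMatrix (2 * K) (n + 1) t).det /
          (hermiteWronskianMatrix (2 * K) n t).det)) t := by
  have hnorm : ∀ (s : ℝ) (q : ℕ → ℝ[X]),
      IsMonicOrthogonalSequence (perturbedHermiteWeight K s) q →
      gaussianFunctional (monicHermite n * monicHermite n) *
        (hermiteWronskianMatrix (2 * K) (n + 1) s).det /
          (hermiteWronskianMatrix (2 * K) n s).det =
        perturbedFunctional (2 * K) s (q n * q n) := fun s q hq => by
    rw [div_eq_iff (det_hermiteWronskianMatrix_ne_zero (even_two_mul K) n s)]
    exact (perturbedFunctional_mul_self_mul_det (even_two_mul K) (by omega) (hq.monic n)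
      (hq.natDegree_eq n) fun _ hr => hq.perturbedFunctional_mul_eq_zero hr).symm
  have hF := hasDerivAt_perturbedFunctional_mul_self (m := 2 * K) (by omega) (hp.monic n)
    (hp.natDegree_eq n) fun _ hr => hp.perturbedFunctional_mul_eq_zero hr
  rw [h.perturbedFunctional_X_mul hp, ← hnorm t p hp, ← mul_assoc] at hF
  have hR : DifferentiableAt ℝ (fun s => gaussianFunctional (monicHermite n * monicHermite n) *
      (hermiteWronskianMatrix (2 * K) (n + 1) s).det /
        (hermiteWronskianMatrix (2 * K) n s).det) t :=
    ((differentiable_det_hermiteWronskianMatrix _ _ t).const_mul _).div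
      (differentiable_det_hermiteWronskianMatrix _ _ t)
      (det_hermiteWronskianMatrix_ne_zero (even_two_mul K) n t)
  have hmin : IsLocalMin ((fun s => perturbedFunctional (2 * K) s (p n * p n)) -
      fun s => gaussianFunctional (monicHermite n * monicHermite n) *
        (hermiteWronskianMatrix (2 * K) (n + 1) s).det /
          (hermiteWronskianMatrix (2 * K) n s).det) t := by
    refine .of_forall fun s => ?_
    have hq := isMonicOrthogonalSequence_monicOrthogonal K s
    simp only [Pi.sub_apply]
    rw [hnorm t p hp, hnorm s _ hq, sub_self, sub_nonneg]
    exact perturbedFunctional_mul_self_le (even_two_mul K) (hq.monic n) (hq.natDegree_eq n)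
      (hp.monic n) (hp.natDegree_eq n) fun _ hr => hq.perturbedFunctional_mul_eq_zero hr
  have h0 := hmin.hasDerivAt_eq_zero (hF.sub hR.hasDerivAt)
  exact hR.hasDerivAt.congr_deriv (sub_eq_zero.1 h0).symm

theorem hermiteWronskian_quotient_pos {K : ℕ} (hK : 0 < K) (n : ℕ) (s : ℝ) :
    0 < gaussianFunctional (monicHermite n * monicHermite n) *
      (hermiteWronskianMatrix (2 * K) (n + 1) s).det /
        (hermiteWronskianMatrix (2 * K) n s).det := by
  have hq := isMonicOrthogonalSequence_monicOrthogonal K s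
  have h := hq.norm_sq_pos n
  rw [integral_eq_perturbedFunctional] at h
  rwa [← perturbedFunctional_mul_self_mul_det (even_two_mul K) (by omega) (hq.monic n)
    (hq.natDegree_eq n) fun _ hr => hq.perturbedFunctional_mul_eq_zero hr,
    mul_div_cancel_right₀ _ (det_hermiteWronskianMatrix_ne_zero (even_two_mul K) n s)]

theorem theorem2 (K : ℕ) (hK : 0 < K) (c : ℂ) (hc : c ^ 2 = -(3 / 2)) (t : ℝ) :
    (∃ (p : ℕ → ℝ[X]) (α β : ℕ → ℝ),
      IsMonicOrthogonalSequence (perturbedHermiteWeight K t) p ∧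
        HasRecurrenceCoefficients p α β) ∧
    ∀ (p : ℕ → ℝ[X]) (α β : ℕ → ℝ),
      IsMonicOrthogonalSequence (perturbedHermiteWeight K t) p →
      HasRecurrenceCoefficients p α β →
      ∀ n : ℕ,
        (genHermite (2 * K) n).eval ((t : ℂ) / c) ≠ 0 ∧
        (genHermite (2 * K) (n + 1)).eval ((t : ℂ) / c) ≠ 0 ∧
        DifferentiableAt ℝ (fun s : ℝ => Complex.log
          ((genHermite (2 * K) (n + 1)).eval ((s : ℂ) / c) /
            (genHermite (2 * K) n).eval ((s : ℂ) / c))) t ∧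
        (α n : ℂ) = -(1 / 2) * deriv (fun s : ℝ => Complex.log
          ((genHermite (2 * K) (n + 1)).eval ((s : ℂ) / c) /
            (genHermite (2 * K) n).eval ((s : ℂ) / c))) t := by
  refine ⟨?_, fun p α β hp h n => ?_⟩
  · obtain ⟨α, β, h⟩ :=
      exists_hasRecurrenceCoefficients_monicOrthogonal (perturbedFunctional (2 * K) t)
    exact ⟨_, α, β, isMonicOrthogonalSequence_monicOrthogonal K t, h⟩
  have hne : ∀ n (s : ℝ), (genHermite (2 * K) n).eval ((s : ℂ) / c) ≠ 0 := fun n s h0 => by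
    obtain ⟨κ, -, hκ⟩ := det_hermiteWronskianMatrix_eq_genHermite hc (2 * K) n
    have h1 := hκ s
    rw [h0, mul_zero] at h1
    exact det_hermiteWronskianMatrix_ne_zero (even_two_mul K) n s (by exact_mod_cast h1)
  obtain ⟨κ₀, hκ₀, h₀⟩ := det_hermiteWronskianMatrix_eq_genHermite hc (2 * K) n
  obtain ⟨κ₁, hκ₁, h₁⟩ := det_hermiteWronskianMatrix_eq_genHermite hc (2 * K) (n + 1)
  set g := gaussianFunctional (monicHermite n * monicHermite n) with hg
  have hg0 : (g : ℂ) ≠ 0 := by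
    exact_mod_cast
      (gaussianFunctional_mul_self_pos (monicHermite_monic_natDegree n).1.ne_zero).ne'
  have hκ : κ₀ / (g * κ₁) ≠ 0 := div_ne_zero hκ₀ (mul_ne_zero hg0 hκ₁)
  -- The quotient may be negative; up to a constant factor it is positive, and `log` of that
  -- factor is an additive constant.
  have hlog : (fun s : ℝ => Complex.log ((genHermite (2 * K) (n + 1)).eval ((s : ℂ) / c) /
      (genHermite (2 * K) n).eval ((s : ℂ) / c))) = fun s : ℝ =>
      ((Real.log (g * (hermiteWronskianMatrix (2 * K) (n + 1) s).det /
        (hermiteWronskianMatrix (2 * K) n s).det) : ℝ) : ℂ) +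
        Complex.log (κ₀ / (g * κ₁)) := by
    funext s
    rw [← Complex.log_ofReal_mul (hermiteWronskian_quotient_pos hK n s) hκ]
    congr 1
    push_cast
    rw [h₀, h₁, ← hg]
    have := hne n s
    field_simp
  have hpos := hermiteWronskian_quotient_pos hK n t
  have hd := (((hasDerivAt_hermiteWronskian_quotient hK hp h n).log hpos.ne').ofReal_comp).add_const
    (Complex.log (κ₀ / (g * κ₁)))
  rw [mul_div_cancel_right₀ _ hpos.ne'] at hd
  rw [hlog]
  refine ⟨hne n t, hne (n + 1) t, hd.differentiableAt, ?_⟩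
  rw [hd.deriv]
  push_cast
  ring
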